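/- Let $\mathbb S^d=\{x\in\mathbb R^{d+1}:\|x\|_2=1\}$ with its normalized surface measure $\pi_d$, for $d\in\mathbb N=\{1,2,\dots\}$. For $x\in\mathbb S^d$ and $t\in[-1,1]$ let $C(x,t)=\{y\in\mathbb S^d:\langle x,y\rangle>t\}$, and let $\mathcal S_d=\{C(x,t)\cap C(y,s): x,y\in\mathbb S^d,\ s,t\in[-1,1]\}$ be the family of spherical slices. The dispersion of a finite set $\mathcal P\subseteq\mathbb S^d$ is $$\operatorname{disp}(\mathcal P;d)=\sup\{\pi_d(B): B\in\mathcal S_d,\ \mathcal P\cap B=\emptyset\}.$$ For $n\in\mathbb N$ let $\mathcal P_n=\{X_1,\dots,X_n\}$ with $X_1,\dots,X_n$ independent and $\pi_d$-distributed, and for $\varepsilon\in(0,1)$ set $$\widetilde N(\varepsilon,d)=\min\{n\in\mathbb N:\ \mathbb E[\operatorname{disp}(\mathcal P_n;d)]\le\varepsilon\}.$$ Then for all $d\in\mathbb N$ and all $\varepsilon\in(0,\frac1{9e})$ the minimum exists and $$\max\Big\{\frac1\varepsilon+d-2,\ \frac1{2\varepsilon}+2d-2,\ \frac1{9\varepsilon}\log\Big(\frac1{9\varepsilon}\Big)\Big\}\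 \le\ \widetilde N(\varepsilon,d)\ \le\ 96\,\frac d\varepsilon\,\log\Big(\frac{96}\varepsilon\Big).$$ Consequently the dependence of the upper bound on $\varepsilon$ and on $d$ is individually optimal up to constants: for each fixed $d\in\mathbb N$, $\widetilde N(\varepsilon,d)=\Theta\big(\frac1\varepsilon\log\frac1\varepsilon\big)$ as $\varepsilon\to0^+$, and for each fixed $\varepsilon\in(0,\frac1{9e})$, $\widetilde N(\varepsilon,d)=\Theta(d)$ as $d\to\infty$. -/

import Mathlib

open MeasureTheory
open scoped ENNReal

namespace SphericalDispersion

/-- The Euclidean unit sphere `𝕊^d` of `ℝ^(d+1)`. -/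
abbrev Sph (d : ℕ) : Type :=
  Metric.sphere (0 : EuclideanSpace ℝ (Fin (d + 1))) 1

/-- The normalized surface measure (uniform distribution) `π_d` on `𝕊^d`: the surface measure
induced by Lebesgue measure on `ℝ^(d+1)`, divided by its total mass. -/
noncomputable def sphereMeasure (d : ℕ) : Measure (Sph d) :=
  ((volume : Measure (EuclideanSpace ℝ (Fin (d + 1)))).toSphere Set.univ)⁻¹ •
    (volume : Measure (EuclideanSpace ℝ (Fin (d + 1)))).toSphere

instance sphereMeasure_isProbabilityMeasure (d : ℕ) :
    IsProbabilityMeasure (sphereMeasure d) where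
  measure_univ := by
    have h0 : (volume : Measure (EuclideanSpace ℝ (Fin (d + 1)))).toSphere Set.univ ≠ 0 := by
      rw [Ne, Measure.measure_univ_eq_zero]
      exact Measure.toSphere_ne_zero _
    simp only [sphereMeasure, Measure.smul_apply, smul_eq_mul]
    exact ENNReal.inv_mul_cancel h0 (measure_ne_top _ _)

/-- The open spherical cap `C(x,t) = {y ∈ 𝕊^d : ⟨x,y⟩ > t}`. -/
def cap {d : ℕ} (x : Sph d) (t : ℝ) : Set (Sph d) :=
  {y | t < inner ℝ (x : EuclideanSpace ℝ (Fin (d + 1))) (y : EuclideanSpace ℝ (Fin (d + 1)))}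

/-- The family of spherical slices, i.e. of the intersections of two spherical caps. -/
def slices (d : ℕ) : Set (Set (Sph d)) :=
  {B | ∃ x y : Sph d, ∃ t ∈ Set.Icc (-1 : ℝ) 1, ∃ s ∈ Set.Icc (-1 : ℝ) 1,
    B = cap x t ∩ cap y s}

/-- The spherical dispersion of a point set `P ⊆ 𝕊^d`: the supremum of the measures of the
spherical slices that contain no point of `P`. -/
noncomputable def disp {d : ℕ} (P : Set (Sph d)) : ℝ≥0∞ :=
  ⨆ B ∈ {B ∈ slices d | P ∩ B = ∅}, sphereMeasure d B

/-- The expected dispersion of `{X_1, …, X_n}` for independent `π_d`-distributed `X_1, …, X_n`: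
the integral of the dispersion with respect to the joint law, the `n`-fold product of `π_d`. -/
noncomputable def expectedDisp (n d : ℕ) : ℝ≥0∞ :=
  ∫⁻ X : Fin n → Sph d, disp (Set.range X) ∂(Measure.pi fun _ : Fin n => sphereMeasure d)

/-- The positive numbers `n` of random points with expected dispersion at most `ε`. -/
noncomputable def admissible (ε : ℝ) (d : ℕ) : Set ℕ :=
  {n | 1 ≤ n ∧ expectedDisp n d ≤ ENNReal.ofReal ε}

/-- The inverse of the expected dispersion, `Ñ(ε,d)`: the least admissible number of points. -/
noncomputable def invExpectedDisp (ε : ℝ) (d : ℕ) : ℕ :=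
  sInf (admissible ε d)

end SphericalDispersion

namespace SphericalDispersion

/-! ### Invariance and null sets of the uniform distribution on the sphere -/

/-! Lower bounds. Take an orthonormal pair `u`, `v` and cut the sphere into `N` lunes of angle
`2π/N` with respect to their plane. Lunes are intersections of two open hemispheres, hence slices;
reflections permute neighbouring ones and their boundaries are null, so each has measure at least
`1/N` (`inv_le_sphereMeasure_lune`). If `u`, `v` are orthogonal to `d - 1` of the points, those
points lie in no open lune, and fewer than `N` remaining points must miss a lune (`inv_le_disp`).
Similarly, at most `3d - 2` points always leave a quarter of the sphere empty (`quarter_le_disp`).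
The bound with `2d` is the average of the two resulting inequalities. The logarithm is a coupon
collector effect: the events that the individual lunes are empty are negatively correlated, so once
the expected number of empty lunes is at least 1, some lune is empty with probability at least `1/2`
(`inv_le_expectedDisp`).

Upper bound. Compare the sample `X` with an independent ghost sample `Y`: the measure of a slice is
the expected proportion of `Y` in it. Swapping `X i` and `Y i` independently preserves the joint
law, and a fixed set of more than `m` of the `2n` points avoids the swapped `X` with probability at
most `2^(-m)`. A union bound over the `K` patterns that slices cut out of `2n` points gives expected
dispersion at most `m/n + K/2^m` (`lintegral_emptyProportion_le`). Radon's theorem and the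
Sauer–Shelah lemma bound `K` by the square of a sum of binomial coefficients
(`card_patterns_countableSlice_le`), and it remains to choose `n` and `m`.

The dispersion is never shown to be measurable: it is only compared with measurable functions
through monotonicity of `lintegral`. -/

open scoped Pointwise in
theorem sphereMeasure_preimage_isometry {d : ℕ}
    (A : EuclideanSpace ℝ (Fin (d + 1)) ≃ₗᵢ[ℝ] EuclideanSpace ℝ (Fin (d + 1)))
    {s t : Set (Sph d)} (hs : MeasurableSet s) (ht : MeasurableSet t)
    (hst : ∀ x y : Sph d, (y : EuclideanSpace ℝ (Fin (d + 1))) = A x → (x ∈ s ↔ y ∈ t)) :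
    sphereMeasure d s = sphereMeasure d t := by
  -- `toSphere` measures a set through the volume of the cone over it; the isometry carries one cone
  -- to the other and preserves volume.
  have key : Set.Ioo (0 : ℝ) 1 • ((↑) '' s : Set (EuclideanSpace ℝ (Fin (d + 1)))) =
      A ⁻¹' (Set.Ioo (0 : ℝ) 1 • ((↑) '' t : Set (EuclideanSpace ℝ (Fin (d + 1))))) := by
    ext z
    simp only [Set.mem_preimage, Set.mem_smul, Set.mem_image]
    constructor
    · rintro ⟨r, hr, _, ⟨x, hx, rfl⟩, rfl⟩
      have hn : ‖A x‖ = 1 := by simp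
      exact ⟨r, hr, _, ⟨⟨A x, mem_sphere_zero_iff_norm.2 hn⟩, (hst x _ rfl).1 hx, rfl⟩, by simp⟩
    · rintro ⟨r, hr, _, ⟨y, hy, rfl⟩, hz⟩
      have hn : ‖A.symm y‖ = 1 := by simp
      refine ⟨r, hr, _, ⟨⟨A.symm y, mem_sphere_zero_iff_norm.2 hn⟩,
        (hst _ y (by simp)).2 hy, rfl⟩, ?_⟩
      apply A.injective
      simp [← hz]
  have hA := A.measurePreserving.measure_preimage_equiv (f := A.toMeasurableEquiv)
    (Set.Ioo (0 : ℝ) 1 • ((↑) '' t : Set (EuclideanSpace ℝ (Fin (d + 1)))))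
  simp only [sphereMeasure, Measure.smul_apply]
  rw [Measure.toSphere_apply' _ hs, Measure.toSphere_apply' _ ht, key]
  congr 2

open scoped Pointwise in
theorem sphereMeasure_inner_eq_zero {d : ℕ} {w : EuclideanSpace ℝ (Fin (d + 1))} (hw : w ≠ 0) :
    sphereMeasure d {y | inner ℝ w (y : EuclideanSpace ℝ (Fin (d + 1))) = 0} = 0 := by
  have hm : MeasurableSet {y : Sph d | inner ℝ w (y : EuclideanSpace ℝ (Fin (d + 1))) = 0} :=
    (isClosed_eq (by fun_prop) continuous_const).measurableSet
  simp only [sphereMeasure, Measure.smul_apply]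
  rw [Measure.toSphere_apply' _ hm]
  have : (volume : Measure (EuclideanSpace ℝ (Fin (d + 1))))
      (Set.Ioo (0 : ℝ) 1 • ((↑) '' {y : Sph d | inner ℝ w (y : EuclideanSpace ℝ (Fin (d + 1))) = 0}))
      = 0 := by
    refine measure_mono_null (t := ((ℝ ∙ w)ᗮ : Submodule ℝ (EuclideanSpace ℝ (Fin (d + 1))))) ?_
      (Measure.addHaar_submodule _ _ ?_)
    · intro z hz
      obtain ⟨r, hr, _, ⟨x, hx, rfl⟩, rfl⟩ := hz
      rw [SetLike.mem_coe, Submodule.mem_orthogonal_singleton_iff_inner_right]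
      simp only [inner_smul_right]
      rw [show inner ℝ w (x : EuclideanSpace ℝ (Fin (d + 1))) = 0 from hx, mul_zero]
    · intro h
      have h' : w ∈ (ℝ ∙ w)ᗮ := h ▸ Submodule.mem_top
      rw [Submodule.mem_orthogonal_singleton_iff_inner_right] at h'
      exact hw (inner_self_eq_zero.1 h')
  rw [this]
  simp

theorem exists_unit_orthogonal {d : ℕ} (s : Finset (EuclideanSpace ℝ (Fin (d + 1))))
    (hs : s.card ≤ d) :
    ∃ u : Sph d, ∀ x ∈ s, inner ℝ (u : EuclideanSpace ℝ (Fin (d + 1))) x = 0 := by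
  set K := Submodule.span ℝ (s : Set (EuclideanSpace ℝ (Fin (d + 1))))
  have hK : Kᗮ ≠ ⊥ := by
    intro h
    have h1 := finrank_span_finset_le_card (R := ℝ) s
    have h2 := K.finrank_add_finrank_orthogonal
    rw [h] at h2
    simp only [finrank_bot, finrank_euclideanSpace, Fintype.card_fin] at h2
    change Module.finrank ℝ K ≤ _ at h1
    omega
  obtain ⟨z, hz, hz0⟩ := Submodule.exists_mem_ne_zero_of_ne_bot hK
  have hn : ‖z‖ ≠ 0 := norm_ne_zero_iff.2 hz0
  refine ⟨⟨‖z‖⁻¹ • z, mem_sphere_zero_iff_norm.2 (by simp [norm_smul, hn])⟩, fun x hx => ?_⟩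
  have : inner ℝ z x = 0 := by
    rw [real_inner_comm]
    exact hz x (Submodule.subset_span hx)
  simp [inner_smul_left, this]

/-! ### Slices and lower bounds for the dispersion -/

theorem measurableSet_cap {d : ℕ} (x : Sph d) (t : ℝ) : MeasurableSet (cap x t) :=
  (isOpen_lt continuous_const (by fun_prop)).measurableSet

theorem le_disp {d : ℕ} {P B : Set (Sph d)} (hB : B ∈ slices d) (hPB : P ∩ B = ∅) :
    sphereMeasure d B ≤ disp P :=
  le_iSup₂_of_le (f := fun B (_ : B ∈ {B ∈ slices d | P ∩ B = ∅}) => sphereMeasure d B)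
    B ⟨hB, hPB⟩ le_rfl

/-! ### Lunes -/

/-- The signed distance of `y` to the hyperplane through the origin that contains
`cos θ • u + sin θ • v` and the orthogonal complement of the plane spanned by `u` and `v`. -/
noncomputable def height {d : ℕ} (u v : Sph d) (θ : ℝ) (y : Sph d) : ℝ :=
  Real.cos θ * inner ℝ (v : EuclideanSpace ℝ (Fin (d + 1))) (y : EuclideanSpace ℝ (Fin (d + 1))) -
    Real.sin θ * inner ℝ (u : EuclideanSpace ℝ (Fin (d + 1))) (y : EuclideanSpace ℝ (Fin (d + 1)))

/-- The `j`-th of the open lunes of angle `α` with respect to the plane spanned by `u`, `v`. -/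
def lune {d : ℕ} (u v : Sph d) (α : ℝ) (j : ℕ) : Set (Sph d) :=
  {y | 0 < height u v (j * α) y ∧ height u v ((j + 1) * α) y < 0}

theorem continuous_height {d : ℕ} (u v : Sph d) (θ : ℝ) : Continuous (height u v θ) := by
  unfold height
  fun_prop

theorem measurableSet_lune {d : ℕ} (u v : Sph d) (α : ℝ) (j : ℕ) :
    MeasurableSet (lune u v α j) :=
  ((isOpen_lt continuous_const (continuous_height u v _)).inter
    (isOpen_lt (continuous_height u v _) continuous_const)).measurableSet

/-- The unit normal vector of the hyperplane in the definition of `height`. -/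
noncomputable def normal {d : ℕ} (u v : Sph d) (θ : ℝ) : EuclideanSpace ℝ (Fin (d + 1)) :=
  Real.cos θ • (v : EuclideanSpace ℝ (Fin (d + 1))) -
    Real.sin θ • (u : EuclideanSpace ℝ (Fin (d + 1)))

theorem inner_normal {d : ℕ} (u v : Sph d) (θ : ℝ) (y : Sph d) :
    inner ℝ (normal u v θ) (y : EuclideanSpace ℝ (Fin (d + 1))) = height u v θ y := by
  simp [normal, height, inner_sub_left, inner_smul_left]

section Orthonormal

variable {d : ℕ} {u v : Sph d}

theorem inner_self_sph (x : Sph d) :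
    inner ℝ (x : EuclideanSpace ℝ (Fin (d + 1))) (x : EuclideanSpace ℝ (Fin (d + 1))) = (1 : ℝ) := by
  rw [real_inner_self_eq_norm_sq, norm_eq_of_mem_sphere x, one_pow]

theorem inner_normal_normal
    (huv : inner ℝ (u : EuclideanSpace ℝ (Fin (d + 1))) (v : EuclideanSpace ℝ (Fin (d + 1))) = 0)
    (θ : ℝ) : inner ℝ (normal u v θ) (normal u v θ) = (1 : ℝ) := by
  have hvu := huv
  rw [real_inner_comm] at hvu
  simp only [normal, inner_sub_left, inner_sub_right, inner_smul_left, inner_smul_right,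
    inner_self_sph, huv, hvu]
  simp only [conj_trivial, mul_one, mul_zero, sub_zero, zero_sub]
  nlinarith [Real.sin_sq_add_cos_sq θ]

theorem norm_normal
    (huv : inner ℝ (u : EuclideanSpace ℝ (Fin (d + 1))) (v : EuclideanSpace ℝ (Fin (d + 1))) = 0)
    (θ : ℝ) : ‖normal u v θ‖ = 1 := by
  have := inner_normal_normal huv θ
  rw [real_inner_self_eq_norm_sq] at this
  exact (pow_eq_one_iff_of_nonneg (norm_nonneg _) two_ne_zero).1 this

theorem lune_mem_slices
    (huv : inner ℝ (u : EuclideanSpace ℝ (Fin (d + 1))) (v : EuclideanSpace ℝ (Fin (d + 1))) = 0)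
    (α : ℝ) (j : ℕ) : lune u v α j ∈ slices d := by
  refine ⟨⟨normal u v (j * α), mem_sphere_zero_iff_norm.2 (norm_normal huv _)⟩,
    ⟨-normal u v ((j + 1) * α), mem_sphere_zero_iff_norm.2 (by rw [norm_neg, norm_normal huv])⟩,
    0, by simp, 0, by simp, ?_⟩
  ext y
  simp [lune, cap, inner_normal, inner_neg_left]

/-- The reflection in the hyperplane separating the two neighbouring lunes interchanges them. -/
theorem sphereMeasure_lune_succ
    (huv : inner ℝ (u : EuclideanSpace ℝ (Fin (d + 1))) (v : EuclideanSpace ℝ (Fin (d + 1))) = 0)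
    (α : ℝ) (j : ℕ) :
    sphereMeasure d (lune u v α (j + 1)) = sphereMeasure d (lune u v α j) := by
  set θ : ℝ := (j + 1) * α with hθ
  set w := normal u v θ
  have hw : ‖w‖ = 1 := norm_normal huv θ
  refine sphereMeasure_preimage_isometry ((ℝ ∙ w)ᗮ.reflection) (measurableSet_lune ..)
    (measurableSet_lune ..) fun x y hxy => ?_
  have hy : (y : EuclideanSpace ℝ (Fin (d + 1))) = x - (2 * height u v θ x) • w := by
    rw [hxy, Submodule.reflection_orthogonal_apply, Submodule.reflection_singleton_apply,
      hw, inner_normal]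
    simp only [RCLike.ofReal_real_eq_id, id_eq, one_pow, div_one, neg_sub, mul_smul, two_smul]
  have hvu := huv
  rw [real_inner_comm] at hvu
  -- In polar angles the reflection is `θ + s ↦ θ - s`; it reverses orientation, hence the sign.
  have hrefl : ∀ s : ℝ, height u v (θ + s) y = - height u v (θ - s) x := by
    intro s
    have : height u v (θ + s) y = height u v (θ + s) x - 2 * height u v θ x * Real.cos s := by
      rw [← inner_normal, hy, inner_sub_right, inner_normal, inner_smul_right]
      congr 2
      simp only [w, normal, inner_sub_left, inner_sub_right, inner_smul_left, inner_smul_right,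
        inner_self_sph, huv, hvu]
      simp only [conj_trivial, mul_one, mul_zero, sub_zero, zero_sub]
      rw [mul_neg, sub_neg_eq_add, ← Real.cos_sub, sub_add_cancel_left, Real.cos_neg]
    rw [this]
    simp only [height, Real.cos_add, Real.cos_sub, Real.sin_add, Real.sin_sub]
    ring
  have h1 := hrefl (-α)
  have h2 := hrefl 0
  rw [show θ + -α = j * α by rw [hθ]; ring, show θ - -α = (j + 1 + 1) * α by rw [hθ]; ring] at h1
  rw [add_zero, sub_zero] at h2
  simp only [lune, Set.mem_ofPred_eq, Nat.cast_add, Nat.cast_one, ← hθ, h1, h2]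
  constructor <;> rintro ⟨h3, h4⟩ <;> constructor <;> linarith

theorem sphereMeasure_lune_eq
    (huv : inner ℝ (u : EuclideanSpace ℝ (Fin (d + 1))) (v : EuclideanSpace ℝ (Fin (d + 1))) = 0)
    (α : ℝ) (j : ℕ) :
    sphereMeasure d (lune u v α j) = sphereMeasure d (lune u v α 0) := by
  induction j with
  | zero => rfl
  | succ j ih => rw [sphereMeasure_lune_succ huv, ih]

end Orthonormal

/-- Polar angle and radius of the projection to the plane spanned by `u`, `v`. -/
theorem exists_polar {d : ℕ} (u v y : Sph d) :
    ∃ r φ : ℝ, 0 ≤ r ∧ 0 ≤ φ ∧ φ < 2 * Real.pi ∧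
      ∀ θ, height u v θ y = r * Real.sin (φ - θ) := by
  set z : ℂ := ⟨inner ℝ (u : EuclideanSpace ℝ (Fin (d + 1))) (y : EuclideanSpace ℝ (Fin (d + 1))),
    inner ℝ (v : EuclideanSpace ℝ (Fin (d + 1))) (y : EuclideanSpace ℝ (Fin (d + 1)))⟩
  have hre : ‖z‖ * Real.cos z.arg =
    inner ℝ (u : EuclideanSpace ℝ (Fin (d + 1))) (y : EuclideanSpace ℝ (Fin (d + 1))) :=
    Complex.norm_mul_cos_arg z
  have him : ‖z‖ * Real.sin z.arg =
    inner ℝ (v : EuclideanSpace ℝ (Fin (d + 1))) (y : EuclideanSpace ℝ (Fin (d + 1))) :=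
    Complex.norm_mul_sin_arg z
  have key : ∀ θ, height u v θ y = ‖z‖ * Real.sin (z.arg - θ) := by
    intro θ
    rw [height, ← hre, ← him, Real.sin_sub]
    ring
  by_cases h : 0 ≤ z.arg
  · exact ⟨‖z‖, z.arg, norm_nonneg _, h, by linarith [Complex.arg_le_pi z, Real.pi_pos], key⟩
  · push Not at h
    refine ⟨‖z‖, z.arg + 2 * Real.pi, norm_nonneg _, by linarith [Complex.neg_pi_lt_arg z],
      by linarith, fun θ => ?_⟩
    rw [key, show z.arg + 2 * Real.pi - θ = z.arg - θ + 2 * Real.pi by ring, Real.sin_add_two_pi]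

/-- Sine is nonpositive on `[-π, 0]` and on `[π, 2π]`. -/
theorem sin_pos_cases {x : ℝ} (hs : 0 < Real.sin x) (h2 : x ≤ 2 * Real.pi) : (0 < x ∧ x < Real.pi) ∨ x < -Real.pi := by
  by_contra! h
  by_cases h0 : 0 < x
  · have := Real.sin_nonneg_of_nonneg_of_le_pi (x := x - Real.pi) (by linarith [h.1 h0])
      (by linarith)
    rw [Real.sin_sub_pi] at this
    linarith
  · have := Real.sin_nonpos_of_nonpos_of_neg_pi_le (x := x) (by linarith) (by linarith [h.2])
    linarith

section Partition

variable {d : ℕ} {u v : Sph d} {N : ℕ}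

theorem exists_angle_of_mem_lune (hN : 2 ≤ N) (y : Sph d) :
    ∃ φ : ℝ, ∀ j < N, y ∈ lune u v (2 * Real.pi / N) j →
      j * (2 * Real.pi / N) < φ ∧ φ < (j + 1) * (2 * Real.pi / N) := by
  obtain ⟨r, φ, hr, hφ0, hφ, key⟩ := exists_polar u v y
  refine ⟨φ, fun j hj hy => ?_⟩
  have hN0 : (0 : ℝ) < N := by positivity
  obtain ⟨h1, h2⟩ := hy
  set α := 2 * Real.pi / N with hα
  have hα0 : 0 < α := by positivity
  have hNα : N * α = 2 * Real.pi := by rw [hα]; field_simp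
  have hj' : ((j : ℝ) + 1) * α ≤ 2 * Real.pi := by
    rw [← hNα]
    gcongr
    exact_mod_cast hj
  have hj0 : 0 ≤ (j : ℝ) * α := by positivity
  rw [key] at h1 h2
  have hs1 : 0 < Real.sin (φ - j * α) := pos_of_mul_pos_right h1 hr
  have hs2 : 0 < Real.sin ((j + 1) * α - φ) := by
    rw [← neg_sub, Real.sin_neg]
    by_contra h
    nlinarith
  -- The two arguments add up to `α > 0`, so if one were below `-π`, the other would exceed `π`,
  -- which neither alternative allows.
  rcases sin_pos_cases hs1 (by linarith) with h3 | h3 <;>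
    rcases sin_pos_cases hs2 (by linarith) with h4 | h4 <;>
    constructor <;> linarith [Real.pi_pos, h3, h4]

theorem lune_disjoint (hN : 2 ≤ N) {j k : ℕ} (hj : j < N) (hk : k < N) {y : Sph d}
    (hyj : y ∈ lune u v (2 * Real.pi / N) j) (hyk : y ∈ lune u v (2 * Real.pi / N) k) : j = k := by
  obtain ⟨φ, h⟩ := exists_angle_of_mem_lune (u := u) (v := v) hN y
  have hα : 0 < 2 * Real.pi / N := by positivity
  have h1 := h j hj hyj
  have h2 := h k hk hyk
  have h3 : (j : ℝ) < k + 1 := lt_of_mul_lt_mul_right (h1.1.trans h2.2) hα.le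
  have h4 : (k : ℝ) < j + 1 := lt_of_mul_lt_mul_right (h2.1.trans h1.2) hα.le
  norm_cast at h3 h4
  omega

theorem exists_mem_lune (hN : 2 ≤ N) {y : Sph d}
    (hy : ∀ j ≤ N, height u v (j * (2 * Real.pi / N)) y ≠ 0) :
    ∃ j < N, y ∈ lune u v (2 * Real.pi / N) j := by
  obtain ⟨r, φ, hr, hφ0, hφ, key⟩ := exists_polar u v y
  set α := 2 * Real.pi / N with hα
  have hN0 : (0 : ℝ) < N := by positivity
  have hα0 : 0 < α := by positivity
  have hNα : N * α = 2 * Real.pi := by rw [hα]; field_simp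
  -- This is where `2 ≤ N` matters: a wider lune would not be an intersection of two hemispheres.
  have hαπ : α ≤ Real.pi := by
    have : (2 : ℝ) ≤ N := by exact_mod_cast hN
    nlinarith [Real.pi_pos]
  set j := ⌊φ / α⌋₊
  have h1 : j * α ≤ φ := (le_div_iff₀ hα0).1 (Nat.floor_le (by positivity))
  have h2 : φ < (j + 1) * α := (div_lt_iff₀ hα0).1 (Nat.lt_floor_add_one _)
  have hj : j < N := by
    have : (j : ℝ) < N := lt_of_mul_lt_mul_right (by linarith : j * α < N * α) hα0.le
    exact_mod_cast this
  have hy1 := hy j hj.le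
  have hy2 := hy (j + 1) hj
  refine ⟨j, hj, lt_of_le_of_ne ?_ hy1.symm, lt_of_le_of_ne ?_ (by exact_mod_cast hy2)⟩
  · rw [key]
    exact mul_nonneg hr (Real.sin_nonneg_of_nonneg_of_le_pi (by linarith) (by linarith))
  · rw [key]
    exact mul_nonpos_of_nonneg_of_nonpos hr
      (Real.sin_nonpos_of_nonpos_of_neg_pi_le (by linarith) (by linarith))

theorem inv_le_sphereMeasure_lune
    (huv : inner ℝ (u : EuclideanSpace ℝ (Fin (d + 1))) (v : EuclideanSpace ℝ (Fin (d + 1))) = 0)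
    (hN : 2 ≤ N) (j : ℕ) :
    (N : ℝ≥0∞)⁻¹ ≤ sphereMeasure d (lune u v (2 * Real.pi / N) j) := by
  set α := 2 * Real.pi / N
  have hcover : (Set.univ : Set (Sph d)) ⊆ (⋃ j ∈ Finset.range N, lune u v α j) ∪
      ⋃ j ∈ Finset.range (N + 1), {y | inner ℝ (normal u v (j * α))
        (y : EuclideanSpace ℝ (Fin (d + 1))) = 0} := by
    intro y _
    by_cases hy : ∀ j ≤ N, height u v (j * α) y ≠ 0
    · obtain ⟨j, hj, hyj⟩ := exists_mem_lune hN hy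
      left
      simp only [Finset.mem_range, Set.mem_iUnion, exists_prop]
      exact ⟨j, hj, hyj⟩
    · push Not at hy
      obtain ⟨j, hj, hyj⟩ := hy
      right
      simp only [Finset.mem_range, Set.mem_iUnion, exists_prop, Set.mem_ofPred_eq, inner_normal]
      exact ⟨j, by omega, hyj⟩
  have hnull : sphereMeasure d (⋃ j ∈ Finset.range (N + 1), {y | inner ℝ (normal u v (j * α))
        (y : EuclideanSpace ℝ (Fin (d + 1))) = 0}) = 0 := by
    refine (measure_biUnion_null_iff (Finset.countable_toSet _)).2 fun j _ => ?_
    refine sphereMeasure_inner_eq_zero fun h => ?_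
    have := norm_normal huv (j * α)
    rw [h, norm_zero] at this
    exact zero_ne_one this
  have h1 : (1 : ℝ≥0∞) ≤ N * sphereMeasure d (lune u v α 0) := by
    calc (1 : ℝ≥0∞) = sphereMeasure d Set.univ := measure_univ.symm
      _ ≤ _ := measure_mono hcover
      _ ≤ _ := measure_union_le _ _
      _ = sphereMeasure d (⋃ j ∈ Finset.range N, lune u v α j) := by rw [hnull, add_zero]
      _ ≤ ∑ j ∈ Finset.range N, sphereMeasure d (lune u v α j) := measure_biUnion_finset_le _ _
      _ = _ := by simp [sphereMeasure_lune_eq huv]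
  rw [sphereMeasure_lune_eq huv]
  have hN0 : (N : ℝ≥0∞) ≠ 0 := Nat.cast_ne_zero.2 (by omega)
  rw [← mul_one (N : ℝ≥0∞)⁻¹]
  exact (ENNReal.inv_mul_le_iff hN0 (ENNReal.natCast_ne_top N)).2 h1

end Partition

/-! ### Deterministic lower bounds for the dispersion -/

/-- Pigeonhole after spending `d - 1` points: they are placed on all lune boundaries at once, and `n
- (d - 1) < N` points cannot meet all `N` lunes. -/
theorem inv_le_disp {n d N : ℕ} (hd : 1 ≤ d) (hN : 2 ≤ N) (hn : n + 2 ≤ N + d)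
    (X : Fin n → Sph d) : (N : ℝ≥0∞)⁻¹ ≤ disp (Set.range X) := by
  classical
  set S : Finset (EuclideanSpace ℝ (Fin (d + 1))) :=
    -- The value 0 only fills in when there are fewer than `d - 1` points.
    (Finset.range (d - 1)).image fun i => if h : i < n then (X ⟨i, h⟩ : EuclideanSpace ℝ (Fin (d + 1)))
      else 0
  have hS : S.card ≤ d - 1 := Finset.card_image_le.trans (Finset.card_range _).le
  have hXS : ∀ i : Fin n, i.val < d - 1 → (X i : EuclideanSpace ℝ (Fin (d + 1))) ∈ S :=
    fun i hi => Finset.mem_image.2 ⟨i, Finset.mem_range.2 hi, by simp⟩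
  obtain ⟨u, hu⟩ := exists_unit_orthogonal S (hS.trans (Nat.sub_le _ _))
  obtain ⟨v, hv⟩ := exists_unit_orthogonal
    (insert (u : EuclideanSpace ℝ (Fin (d + 1))) S) ((Finset.card_insert_le _ _).trans (by omega))
  have huv : inner ℝ (u : EuclideanSpace ℝ (Fin (d + 1))) (v : EuclideanSpace ℝ (Fin (d + 1))) = 0 := by
    rw [real_inner_comm]
    exact hv _ (Finset.mem_insert_self _ _)
  obtain ⟨j, hj⟩ : ∃ j : Fin N, ∀ i, X i ∉ lune u v (2 * Real.pi / N) j := by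
    by_contra! h
    choose f hf using h
    -- The first `d - 1` points have height 0 for every angle, so they cannot witness that a lune is
    -- hit.
    have hfd : ∀ j, d - 1 ≤ (f j).val := by
      intro j
      by_contra! hlt
      have h0 := (hf j).1
      simp [height, hu _ (hXS _ hlt), hv _ (Finset.mem_insert_of_mem (hXS _ hlt))] at h0
    have hinj : Function.Injective
        fun j : Fin N => (⟨(f j).val - (d - 1), by have := hfd j; omega⟩ : Fin (n - (d - 1))) := by
      intro j k hjk
      have h1 := hfd j
      have h2 := hfd k
      simp only [Fin.mk.injEq] at hjk
      have hfjk : f j = f k := Fin.ext (by omega)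
      exact Fin.ext (lune_disjoint hN j.2 k.2 (hf j) (hfjk ▸ hf k))
    have hcard := Fintype.card_le_of_injective _ hinj
    simp only [Fintype.card_fin] at hcard
    omega
  refine (inv_le_sphereMeasure_lune huv hN j).trans (le_disp (lune_mem_slices huv _ _) ?_)
  rw [← Set.disjoint_iff_inter_eq_empty, Set.disjoint_left]
  rintro _ ⟨i, rfl⟩
  exact hj i

/-- A hyperplane through the origin and the first `d` points leaves at most `2d - 2` points off it,
so one of its open sides contains at most `d - 1`. -/
theorem exists_few_points_on_open_hemisphere {n d : ℕ} (hn : n + 2 ≤ 3 * d) (X : Fin n → Sph d) :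
    ∃ w : Sph d, (Finset.univ.filter fun i => 0 < inner ℝ (w : EuclideanSpace ℝ (Fin (d + 1)))
      (X i : EuclideanSpace ℝ (Fin (d + 1)))).card + 1 ≤ d := by
  classical
  set S : Finset (EuclideanSpace ℝ (Fin (d + 1))) :=
    (Finset.range d).image fun i => if h : i < n then (X ⟨i, h⟩ : EuclideanSpace ℝ (Fin (d + 1)))
      else 0
  obtain ⟨w, hw⟩ := exists_unit_orthogonal S (Finset.card_image_le.trans (Finset.card_range _).le)
  have hXS : ∀ i : Fin n, i.val < d →
      inner ℝ (w : EuclideanSpace ℝ (Fin (d + 1))) (X i : EuclideanSpace ℝ (Fin (d + 1))) = 0 :=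
    fun i hi => hw _ (Finset.mem_image.2 ⟨i, Finset.mem_range.2 hi, by simp⟩)
  set A := Finset.univ.filter fun i => 0 < inner ℝ (w : EuclideanSpace ℝ (Fin (d + 1)))
      (X i : EuclideanSpace ℝ (Fin (d + 1)))
  set B := Finset.univ.filter fun i => inner ℝ (w : EuclideanSpace ℝ (Fin (d + 1)))
      (X i : EuclideanSpace ℝ (Fin (d + 1))) < 0
  have hAB : Disjoint A B := by
    rw [Finset.disjoint_left]
    intro i hA hB
    exact lt_asymm (Finset.mem_filter.1 hA).2 (Finset.mem_filter.1 hB).2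
  have hsub : (A ∪ B).map Fin.valEmbedding ⊆ Finset.Ico d n := by
    intro k hk
    obtain ⟨i, hi, rfl⟩ := Finset.mem_map.1 hk
    refine Finset.mem_Ico.2 ⟨?_, i.2⟩
    by_contra! hlt
    rcases Finset.mem_union.1 hi with h | h <;>
      have := (Finset.mem_filter.1 h).2 <;> rw [hXS i hlt] at this <;> exact lt_irrefl _ this
  have hcard := Finset.card_le_card hsub
  rw [Finset.card_map, Finset.card_union_of_disjoint hAB, Nat.card_Ico] at hcard
  by_cases hA : A.card + 1 ≤ d
  · exact ⟨w, hA⟩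
  · refine ⟨-w, ?_⟩
    have : (Finset.univ.filter fun i => 0 < inner ℝ ((-w : Sph d) : EuclideanSpace ℝ (Fin (d + 1)))
      (X i : EuclideanSpace ℝ (Fin (d + 1)))) = B := by
      simp [B, inner_neg_left]
    rw [this]
    omega

/-- A second hyperplane, orthogonal to the first and passing through the at most `d - 1` points on
the sparse side, halves that side into empty quarters. -/
theorem quarter_le_disp {n d : ℕ} (hn : n + 2 ≤ 3 * d) (X : Fin n → Sph d) :
    (4 : ℝ≥0∞)⁻¹ ≤ disp (Set.range X) := by
  classical
  obtain ⟨w, hw⟩ := exists_few_points_on_open_hemisphere hn X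
  set A := Finset.univ.filter fun i => 0 < inner ℝ (w : EuclideanSpace ℝ (Fin (d + 1)))
      (X i : EuclideanSpace ℝ (Fin (d + 1)))
  obtain ⟨v, hv⟩ := exists_unit_orthogonal (insert (w : EuclideanSpace ℝ (Fin (d + 1)))
      (A.image fun i => (X i : EuclideanSpace ℝ (Fin (d + 1)))))
    ((Finset.card_insert_le _ _).trans ((Nat.add_le_add_right Finset.card_image_le 1).trans hw))
  have hwv : inner ℝ (w : EuclideanSpace ℝ (Fin (d + 1))) (v : EuclideanSpace ℝ (Fin (d + 1))) = 0 := by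
    rw [real_inner_comm]
    exact hv _ (Finset.mem_insert_self _ _)
  have h4 := inv_le_sphereMeasure_lune (N := 4) hwv (by norm_num) 0
  refine le_trans (by exact_mod_cast h4) (le_disp (lune_mem_slices hwv _ _) ?_)
  rw [← Set.disjoint_iff_inter_eq_empty, Set.disjoint_left]
  rintro _ ⟨i, rfl⟩ ⟨h1, h2⟩
  have hang : ((0 : ℕ) + 1 : ℝ) * (2 * Real.pi / 4) = Real.pi / 2 := by push_cast; ring
  rw [hang] at h2
  simp only [height, Nat.cast_zero, zero_mul, Real.cos_zero, Real.sin_zero, one_mul, sub_zero,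
    Real.cos_pi_div_two, Real.sin_pi_div_two, zero_sub, neg_lt_zero] at h1 h2
  have hiA : i ∈ A := Finset.mem_filter.2 ⟨Finset.mem_univ _, h2⟩
  rw [hv _ (Finset.mem_insert_of_mem (Finset.mem_image_of_mem _ hiA))] at h1
  exact lt_irrefl _ h1

theorem le_expectedDisp {n d : ℕ} {c : ℝ≥0∞} (h : ∀ X : Fin n → Sph d, c ≤ disp (Set.range X)) :
    c ≤ expectedDisp n d := by
  calc c = ∫⁻ _ : Fin n → Sph d, c ∂(Measure.pi fun _ : Fin n => sphereMeasure d) := by simp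
    _ ≤ _ := lintegral_mono h

/-! ### A lower bound by the second moment method -/

/-- With `S` the number of events that occur and `m` its mean, the indicator of `S > 0` dominates
`2cS - c²S²` for every `c`. Nonpositive correlation gives second moment at most `m + m²`, and `c =
1/(1+m)` yields `m/(1+m) ≥ 1/2`. -/
theorem half_le_measure_iUnion {Ω : Type*} [MeasurableSpace Ω] (μ : Measure Ω)
    [IsProbabilityMeasure μ] {ι : Type*} [Fintype ι] (E : ι → Set Ω)
    (hE : ∀ i, MeasurableSet (E i))
    (hcor : ∀ i j, i ≠ j → μ.real (E i ∩ E j) ≤ μ.real (E i) * μ.real (E j))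
    (hsum : 1 ≤ ∑ i, μ.real (E i)) : 1 / 2 ≤ μ.real (⋃ i, E i) := by
  classical
  set m := ∑ i, μ.real (E i) with hm
  set c := (1 + m)⁻¹ with hc
  have hint : ∀ s : Set Ω, MeasurableSet s → Integrable (s.indicator (1 : Ω → ℝ)) μ :=
    fun s hs => (integrable_const (1 : ℝ)).indicator hs
  have hpt : ∀ ω, 2 * c * ∑ i, (E i).indicator (1 : Ω → ℝ) ω -
      c ^ 2 * ∑ i, ∑ j, (E i ∩ E j).indicator (1 : Ω → ℝ) ω ≤
      (⋃ i, E i).indicator (1 : Ω → ℝ) ω := by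
    intro ω
    have hsq : ∑ i, ∑ j, (E i ∩ E j).indicator (1 : Ω → ℝ) ω =
        (∑ i, (E i).indicator (1 : Ω → ℝ) ω) ^ 2 := by
      rw [sq, Finset.sum_mul_sum]
      refine Finset.sum_congr rfl fun i _ => Finset.sum_congr rfl fun j _ => ?_
      rw [Set.inter_indicator_one]
      rfl
    rw [hsq]
    by_cases hω : ω ∈ ⋃ i, E i
    · rw [Set.indicator_of_mem hω, Pi.one_apply]
      nlinarith [sq_nonneg (c * ∑ i, (E i).indicator (1 : Ω → ℝ) ω - 1)]
    · rw [Set.indicator_of_notMem hω]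
      have : ∑ i, (E i).indicator (1 : Ω → ℝ) ω = 0 :=
        Finset.sum_eq_zero fun i _ =>
          Set.indicator_of_notMem (fun h => hω (Set.mem_iUnion.2 ⟨i, h⟩)) _
      simp [this]
  have hI1 : Integrable (fun ω => ∑ i, (E i).indicator (1 : Ω → ℝ) ω) μ :=
    integrable_finsetSum _ fun i _ => hint _ (hE i)
  have hI2 : Integrable (fun ω => ∑ i, ∑ j, (E i ∩ E j).indicator (1 : Ω → ℝ) ω) μ :=
    integrable_finsetSum _ fun i _ => integrable_finsetSum _ fun j _ => hint _ ((hE i).inter (hE j))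
  have hmono := integral_mono ((hI1.const_mul (2 * c)).sub (hI2.const_mul (c ^ 2)))
    (hint _ (MeasurableSet.iUnion hE)) hpt
  have hU : ∫ ω, (⋃ i, E i).indicator (1 : Ω → ℝ) ω ∂μ = μ.real (⋃ i, E i) :=
    integral_indicator_one (MeasurableSet.iUnion hE)
  have h1 : ∫ ω, ∑ i, (E i).indicator (1 : Ω → ℝ) ω ∂μ = m := by
    rw [integral_finsetSum _ fun i _ => hint _ (hE i)]
    exact Finset.sum_congr rfl fun i _ => integral_indicator_one (hE i)
  have h2 : ∫ ω, ∑ i, ∑ j, (E i ∩ E j).indicator (1 : Ω → ℝ) ω ∂μ ≤ m + m ^ 2 := by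
    rw [integral_finsetSum _ fun i _ =>
      integrable_finsetSum _ fun j _ => hint _ ((hE i).inter (hE j))]
    have : ∀ i, ∫ ω, ∑ j, (E i ∩ E j).indicator (1 : Ω → ℝ) ω ∂μ ≤
        μ.real (E i) + ∑ j, μ.real (E i) * μ.real (E j) := by
      intro i
      rw [integral_finsetSum _ fun j _ => hint _ ((hE i).inter (hE j)),
        show μ.real (E i) = ∑ j, if j = i then μ.real (E i) else 0 by simp,
        ← Finset.sum_add_distrib]
      refine Finset.sum_le_sum fun j _ => ?_
      rw [integral_indicator_one ((hE i).inter (hE j))]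
      simp only [Finset.sum_ite_eq', Finset.mem_univ, if_true]
      split_ifs with h
      · subst h
        rw [Set.inter_self]
        have : 0 ≤ μ.real (E j) * μ.real (E j) := by positivity
        linarith
      · rw [zero_add]
        exact hcor i j (Ne.symm h)
    refine (Finset.sum_le_sum fun i _ => this i).trans ?_
    rw [Finset.sum_add_distrib, ← Finset.sum_mul_sum, ← hm, sq]
  rw [integral_sub' (hI1.const_mul _) (hI2.const_mul _), integral_const_mul, integral_const_mul,
    h1, hU] at hmono
  have hc0 : 0 < c := by positivity
  have hcm : c * (1 + m) = 1 := inv_mul_cancel₀ (by positivity)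
  have h3 : c ^ 2 * (m + m ^ 2) = c * m := by
    calc c ^ 2 * (m + m ^ 2) = c * m * (c * (1 + m)) := by ring
      _ = c * m := by rw [hcm, mul_one]
  have h4 := mul_le_mul_of_nonneg_left h2 (sq_nonneg c)
  have h5 : 1 / 2 ≤ c * m := by nlinarith
  linarith

theorem inv_le_expectedDisp {n d N : ℕ} (hd : 1 ≤ d) (hN : 2 ≤ N)
    (hn : 1 ≤ N * (1 - 1 / (N : ℝ)) ^ n) :
    ENNReal.ofReal (1 / (2 * N)) ≤ expectedDisp n d := by
  obtain ⟨u, -⟩ := exists_unit_orthogonal (d := d) ∅ (by simp)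
  obtain ⟨v, hv⟩ := exists_unit_orthogonal {(u : EuclideanSpace ℝ (Fin (d + 1)))} (by simpa using hd)
  have huv : inner ℝ (u : EuclideanSpace ℝ (Fin (d + 1))) (v : EuclideanSpace ℝ (Fin (d + 1))) = 0 := by
    rw [real_inner_comm]
    exact hv _ (Finset.mem_singleton_self _)
  have hN0 : (0 : ℝ) < N := by positivity
  set L : Fin N → Set (Sph d) := fun j => lune u v (2 * Real.pi / N) j
  have hL : ∀ j, MeasurableSet (L j) := fun j => measurableSet_lune ..
  have hdisj : Pairwise (Function.onFun Disjoint L) := fun j k hjk =>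
    Set.disjoint_left.2 fun y hj hk => hjk (Fin.ext (lune_disjoint hN j.2 k.2 hj hk))
  set p := (sphereMeasure d).real (lune u v (2 * Real.pi / N) 0)
  have hp : ∀ j, (sphereMeasure d).real (L j) = p := fun j => by
    simp only [L, p, Measure.real, sphereMeasure_lune_eq huv _ (j : ℕ)]
  have hpN : p ≤ 1 / N := by
    have h1 : (sphereMeasure d).real (⋃ j, L j) = ∑ j, (sphereMeasure d).real (L j) :=
      measureReal_iUnion_fintype hdisj hL
    have h2 : (sphereMeasure d).real (⋃ j, L j) ≤ 1 := measureReal_le_one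
    simp only [h1, hp, Finset.sum_const, Finset.card_univ, Fintype.card_fin, nsmul_eq_mul] at h2
    rwa [le_div_iff₀ hN0, mul_comm]
  set μ := Measure.pi fun _ : Fin n => sphereMeasure d
  set E : Fin N → Set (Fin n → Sph d) := fun j => Set.univ.pi fun _ => (L j)ᶜ
  have hE : ∀ j, MeasurableSet (E j) := fun j => MeasurableSet.univ_pi fun _ => (hL j).compl
  have hpi : ∀ s : Set (Sph d), μ.real (Set.univ.pi fun _ => s) = (sphereMeasure d).real s ^ n := by
    intro s
    simp [μ, Measure.real, Measure.pi_pi, ENNReal.toReal_pow]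
  have hμE : ∀ j, μ.real (E j) = (1 - p) ^ n := fun j => by
    rw [hpi, probReal_compl_eq_one_sub (hL j), hp]
  have hhalf : 1 / 2 ≤ μ.real (⋃ j, E j) := by
    refine half_le_measure_iUnion μ E hE (fun j k hjk => ?_) ?_
    · have h1 : E j ∩ E k = Set.univ.pi fun _ => (L j ∪ L k)ᶜ := by
        rw [← Set.pi_inter_distrib, Set.compl_union]
      have h2 : (sphereMeasure d).real (L j ∪ L k)ᶜ = 1 - 2 * p := by
        rw [probReal_compl_eq_one_sub ((hL j).union (hL k)),
          measureReal_union (hdisj hjk) (hL k), hp, hp, two_mul]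
      rw [h1, hpi, hμE, hμE, ← mul_pow, h2]
      have h3 : 0 ≤ 1 - 2 * p := h2 ▸ measureReal_nonneg
      -- Negative correlation is `1 - 2p ≤ (1 - p)²` raised to the power `n`.
      exact pow_le_pow_left₀ h3 (by nlinarith [sq_nonneg p]) n
    · simp only [hμE, Finset.sum_const, Finset.card_univ, Fintype.card_fin, nsmul_eq_mul]
      refine hn.trans (mul_le_mul_of_nonneg_left (pow_le_pow_left₀ ?_ (by linarith) n) hN0.le)
      rw [sub_nonneg, div_le_one hN0]
      exact_mod_cast (by omega : 1 ≤ N)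
  have hU : MeasurableSet (⋃ j, E j) := MeasurableSet.iUnion hE
  have hle : ∀ X : Fin n → Sph d,
      (⋃ j, E j).indicator (fun _ => (N : ℝ≥0∞)⁻¹) X ≤ disp (Set.range X) := by
    intro X
    refine Set.indicator_le' (s := ⋃ j, E j) (g := fun X : Fin n → Sph d => disp (Set.range X))
      (fun X hX => ?_) (fun _ _ => zero_le) X
    obtain ⟨j, hj⟩ := Set.mem_iUnion.1 hX
    refine (inv_le_sphereMeasure_lune huv hN j).trans (le_disp (lune_mem_slices huv _ _) ?_)
    rw [← Set.disjoint_iff_inter_eq_empty, Set.disjoint_left]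
    rintro _ ⟨i, rfl⟩
    exact hj i trivial
  have hμU : ENNReal.ofReal (1 / 2) ≤ μ (⋃ j, E j) :=
    (ENNReal.ofReal_le_iff_le_toReal (measure_ne_top _ _)).2 hhalf
  calc ENNReal.ofReal (1 / (2 * N)) = (N : ℝ≥0∞)⁻¹ * ENNReal.ofReal (1 / 2) := by
        rw [← ENNReal.ofReal_natCast, ← ENNReal.ofReal_inv_of_pos hN0,
          ← ENNReal.ofReal_mul (by positivity)]
        congr 1
        field_simp
    _ ≤ (N : ℝ≥0∞)⁻¹ * μ (⋃ j, E j) := by gcongr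
    _ = ∫⁻ X, (⋃ j, E j).indicator (fun _ => (N : ℝ≥0∞)⁻¹) X ∂μ := by
        rw [lintegral_indicator_const hU]
    _ ≤ expectedDisp n d := lintegral_mono hle

/-! ### Symmetrization -/

/-- Both sides factor over `i`: with `e` of the two elements over `i` in `I`, the factor `(2 - e) *
2^e` is 2, 2 or 0. -/
theorem card_choices_mul_two_pow_le {n : ℕ} (I : Finset (Fin n × Bool)) :
    (Finset.univ.filter fun σ : Fin n → Bool => ∀ i, (i, σ i) ∉ I).card * 2 ^ I.card ≤ 2 ^ n := by
  classical
  have h1 : (Finset.univ.filter fun σ : Fin n → Bool => ∀ i, (i, σ i) ∉ I) =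
      Fintype.piFinset fun i => Finset.univ.filter fun b => (i, b) ∉ I := by
    ext σ
    simp [Fintype.mem_piFinset]
  have h2 : I.card = ∑ i : Fin n, (Finset.univ.filter fun b => (i, b) ∈ I).card := by
    simp only [Finset.card_filter]
    rw [← Fintype.sum_prod_type (fun p => if p ∈ I then 1 else 0), Finset.sum_boole]
    simp
  rw [h1, Fintype.card_piFinset, h2, ← Finset.prod_pow_eq_pow_sum, ← Finset.prod_mul_distrib]
  calc _ ≤ ∏ _i : Fin n, 2 := Finset.prod_le_prod' fun i _ => ?_
    _ = 2 ^ n := by simp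
  have h3 := Finset.card_filter_add_card_filter_not (s := (Finset.univ : Finset Bool))
    (fun b => (i, b) ∈ I)
  simp only [Finset.card_univ, Fintype.card_bool] at h3
  generalize (Finset.univ.filter fun b => (i, b) ∈ I).card = e at *
  generalize (Finset.univ.filter fun b => (i, b) ∉ I).card = c at *
  have : e ≤ 2 := by omega
  interval_cases e
  · omega
  · omega
  · simp_all

section Abstract

variable {S κ : Type*} {n : ℕ}

/-- The subsets of the index set that the sets `B k` cut out of the points `z`. -/
noncomputable def patterns {ι : Type*} [Fintype ι] (B : κ → Set S) (z : ι → S) :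
    Finset (Finset ι) :=
  open scoped Classical in
  Finset.univ.filter fun I => ∃ k, ∀ p, p ∈ I ↔ z p ∈ B k

/-- The largest proportion of the points `q.2` in a set of the family without points of `q.1`. -/
noncomputable def emptyProportion (B : κ → Set S) (q : (Fin n → S) × (Fin n → S)) : ℝ≥0∞ :=
  ⨆ k, {q : (Fin n → S) × (Fin n → S) | ∀ i, q.1 i ∉ B k}.indicator
    (fun q => (∑ i, (B k).indicator 1 (q.2 i)) / (n : ℝ≥0∞)) q

/-- Exchange the entries of the pairs `Z i` with `σ i = false`. -/
def exchange (σ : Fin n → Bool) (Z : Fin n → S × S) : Fin n → S × S :=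
  fun i => bif σ i then Z i else (Z i).swap

theorem sum_emptyProportion_le (B : κ → Set S) (hn : n ≠ 0) (m K : ℕ)
    (hK : ∀ z : Fin n × Bool → S, (patterns B z).card ≤ K) (Z : Fin n → S × S) :
    ∑ σ : Fin n → Bool, emptyProportion B
      (fun i => (exchange σ Z i).1, fun i => (exchange σ Z i).2) ≤
      2 ^ n * ((m : ℝ≥0∞) / n + K / 2 ^ m) := by
  classical
  set z : Fin n × Bool → S := fun p => bif p.2 then (Z p.1).1 else (Z p.1).2 with hz
  set T := (patterns B z).filter fun I => m < I.card with hT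
  have hX : ∀ (σ : Fin n → Bool) i, (exchange σ Z i).1 = z (i, σ i) := by
    intro σ i
    cases h : σ i <;> simp [exchange, hz, h]
  have hY : ∀ (σ : Fin n → Bool) i, (exchange σ Z i).2 = z (i, !σ i) := by
    intro σ i
    cases h : σ i <;> simp [exchange, hz, h]
  have hn0 : (n : ℝ≥0∞) ≠ 0 := by exact_mod_cast hn
  -- A set without chosen points either has at most `m` ghost points, or its pattern lies in `T` and
  -- avoids `σ`; then the sum is at least 1, which bounds any proportion.
  have hpt : ∀ σ : Fin n → Bool, emptyProportion B
      (fun i => (exchange σ Z i).1, fun i => (exchange σ Z i).2) ≤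
      (m : ℝ≥0∞) / n + ∑ I ∈ T, if ∀ i, (i, σ i) ∉ I then 1 else 0 := by
    intro σ
    refine iSup_le fun k => ?_
    refine Set.indicator_apply_le' (fun hempty => ?_) (fun _ => zero_le)
    simp only [Set.mem_ofPred_eq, hX] at hempty
    simp only [hY]
    have hcount : (∑ i, (B k).indicator (1 : S → ℝ≥0∞) (z (i, !σ i))) =
        ((Finset.univ.filter fun i => z (i, !σ i) ∈ B k).card : ℝ≥0∞) := by
      simp [Set.indicator_apply, Finset.sum_boole]
    rw [hcount]
    set c := (Finset.univ.filter fun i => z (i, !σ i) ∈ B k).card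
    by_cases hcm : c ≤ m
    · refine le_add_right ?_
      gcongr
    · set I : Finset (Fin n × Bool) := Finset.univ.filter fun p => z p ∈ B k with hI
      have hcI : c ≤ I.card :=
        Finset.card_le_card_of_injOn (fun i => (i, !σ i)) (fun i hi => by simpa [hI] using hi)
          (fun i _ j _ hij => congrArg Prod.fst hij)
      have hIT : I ∈ T := by
        simp only [hT, patterns, Finset.mem_filter, Finset.mem_univ, true_and]
        exact ⟨⟨k, fun p => by simp [hI]⟩, by omega⟩
      have h1 : (1 : ℝ≥0∞) ≤ ∑ I ∈ T, if ∀ i, (i, σ i) ∉ I then 1 else 0 := by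
        refine le_trans ?_ (Finset.single_le_sum (fun _ _ => zero_le) hIT)
        rw [if_pos (by simpa [hI] using hempty)]
      refine le_add_left (le_trans ?_ h1)
      refine ENNReal.div_le_of_le_mul ?_
      rw [one_mul]
      have : c ≤ n := (Finset.card_le_univ _).trans (Fintype.card_fin n).le
      exact_mod_cast this
  have hI : ∀ I ∈ T, ∑ σ : Fin n → Bool, (if ∀ i, (i, σ i) ∉ I then (1 : ℝ≥0∞) else 0) ≤
      2 ^ n / 2 ^ m := by
    intro I hI
    rw [Finset.sum_boole, ENNReal.le_div_iff_mul_le (by simp) (by simp)]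
    have h1 := card_choices_mul_two_pow_le I
    have h2 : 2 ^ m ≤ 2 ^ I.card := Nat.pow_le_pow_right two_pos (Finset.mem_filter.1 hI).2.le
    exact_mod_cast (Nat.mul_le_mul_left _ h2).trans h1
  calc _ ≤ ∑ σ : Fin n → Bool,
        ((m : ℝ≥0∞) / n + ∑ I ∈ T, if ∀ i, (i, σ i) ∉ I then 1 else 0) :=
        Finset.sum_le_sum fun σ _ => hpt σ
    _ = 2 ^ n * ((m : ℝ≥0∞) / n) +
        ∑ I ∈ T, ∑ σ : Fin n → Bool, (if ∀ i, (i, σ i) ∉ I then (1 : ℝ≥0∞) else 0) := by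
        rw [Finset.sum_add_distrib, Finset.sum_comm]
        simp
    _ ≤ 2 ^ n * ((m : ℝ≥0∞) / n) + ∑ I ∈ T, 2 ^ n / 2 ^ m := by
        gcongr with I hIT
        exact hI I hIT
    _ ≤ 2 ^ n * ((m : ℝ≥0∞) / n) + K * (2 ^ n / 2 ^ m) := by
        rw [Finset.sum_const, nsmul_eq_mul]
        have : T.card ≤ K := (Finset.card_filter_le _ _).trans (hK z)
        gcongr
    _ = _ := by
        simp only [div_eq_mul_inv]
        ring

variable [MeasurableSpace S]

theorem measurable_emptyProportion [Countable κ] {B : κ → Set S} (hB : ∀ k, MeasurableSet (B k)) :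
    Measurable (emptyProportion (n := n) B) := by
  refine Measurable.iSup fun k => Measurable.indicator ?_ ?_
  · refine Measurable.div_const (Finset.measurable_fun_sum _ fun i _ => ?_) _
    exact (measurable_one.indicator (hB k)).comp ((measurable_pi_apply i).comp measurable_snd)
  · have : {q : (Fin n → S) × (Fin n → S) | ∀ i, q.1 i ∉ B k} =
        ⋂ i, (fun q : (Fin n → S) × (Fin n → S) => q.1 i) ⁻¹' (B k)ᶜ := by
      ext q
      simp
    rw [this]
    exact MeasurableSet.iInter fun i =>
      ((measurable_pi_apply i).comp measurable_fst) (hB k).compl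

theorem lintegral_emptyProportion_le [Countable κ] (μ : Measure S) [IsProbabilityMeasure μ]
    {B : κ → Set S} (hB : ∀ k, MeasurableSet (B k)) (hn : n ≠ 0) (m K : ℕ)
    (hK : ∀ z : Fin n × Bool → S, (patterns B z).card ≤ K) :
    ∫⁻ X : Fin n → S, ∫⁻ Y : Fin n → S, emptyProportion B (X, Y) ∂(Measure.pi fun _ => μ)
      ∂(Measure.pi fun _ => μ) ≤ (m : ℝ≥0∞) / n + K / 2 ^ m := by
  set J := ∫⁻ X : Fin n → S, ∫⁻ Y : Fin n → S, emptyProportion B (X, Y) ∂(Measure.pi fun _ => μ)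
      ∂(Measure.pi fun _ => μ)
  set ν : Measure (Fin n → S × S) := Measure.pi fun _ => μ.prod μ
  have hG := measurable_emptyProportion (n := n) hB
  -- Each pair has law `μ.prod μ`, which is symmetric; hence all `2^n` exchanges give the same
  -- integral `J`.
  have hex : ∀ σ : Fin n → Bool, MeasurePreserving (exchange (S := S) σ) ν ν := by
    intro σ
    refine measurePreserving_pi (fun _ => μ.prod μ) (fun _ => μ.prod μ)
      (f := fun i p => bif σ i then p else p.swap) fun i => ?_
    cases σ i
    · exact Measure.measurePreserving_swap
    · exact MeasurePreserving.id _
  have hmp : ∀ σ : Fin n → Bool, MeasurePreserving (fun Z : Fin n → S × S =>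
      ((fun i => (exchange σ Z i).1, fun i => (exchange σ Z i).2) :
        (Fin n → S) × (Fin n → S))) ν
      ((Measure.pi fun _ => μ).prod (Measure.pi fun _ => μ)) := fun σ =>
    (measurePreserving_arrowProdEquivProdArrow S S (Fin n) (fun _ => μ) (fun _ => μ)).comp (hex σ)
  have hJ : ∀ σ : Fin n → Bool, ∫⁻ Z, emptyProportion B
      (fun i => (exchange σ Z i).1, fun i => (exchange σ Z i).2) ∂ν = J := by
    intro σ
    rw [(hmp σ).lintegral_comp hG, lintegral_prod _ hG.aemeasurable]
  have hsum : (2 : ℝ≥0∞) ^ n * J ≤ 2 ^ n * ((m : ℝ≥0∞) / n + K / 2 ^ m) := by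
    calc (2 : ℝ≥0∞) ^ n * J = ∑ σ : Fin n → Bool, ∫⁻ Z, emptyProportion B
          (fun i => (exchange σ Z i).1, fun i => (exchange σ Z i).2) ∂ν := by
          simp only [hJ]
          simp
      _ = ∫⁻ Z, ∑ σ : Fin n → Bool, emptyProportion B
          (fun i => (exchange σ Z i).1, fun i => (exchange σ Z i).2) ∂ν := by
          exact (lintegral_finsetSum _ fun σ _ => hG.comp (hmp σ).measurable).symm
      _ ≤ ∫⁻ _, 2 ^ n * ((m : ℝ≥0∞) / n + K / 2 ^ m) ∂ν :=
          lintegral_mono fun Z => sum_emptyProportion_le B hn m K hK Z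
      _ = _ := by simp
  exact (ENNReal.mul_le_mul_iff_right (by simp) (by simp)).1 hsum

theorem measure_eq_lintegral_proportion (μ : Measure S) [IsProbabilityMeasure μ] {A : Set S}
    (hA : MeasurableSet A) (hn : n ≠ 0) :
    ∫⁻ Y : Fin n → S, (∑ i, A.indicator 1 (Y i)) / (n : ℝ≥0∞) ∂(Measure.pi fun _ => μ) = μ A := by
  have hm : ∀ i : Fin n, Measurable fun Y : Fin n → S => A.indicator (1 : S → ℝ≥0∞) (Y i) :=
    fun i => (measurable_one.indicator hA).comp (measurable_pi_apply i)
  have h1 : ∀ i : Fin n, ∫⁻ Y : Fin n → S, A.indicator (1 : S → ℝ≥0∞) (Y i)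
      ∂(Measure.pi fun _ => μ) = μ A := by
    intro i
    rw [(measurePreserving_eval (fun _ : Fin n => μ) i).lintegral_comp
      (measurable_one.indicator hA), lintegral_indicator_one hA]
  have hn0 : (n : ℝ≥0∞) ≠ 0 := by exact_mod_cast hn
  simp only [div_eq_mul_inv]
  rw [lintegral_mul_const _ (Finset.measurable_fun_sum _ fun i _ => hm i),
    lintegral_finsetSum _ fun i _ => hm i]
  simp only [h1, Finset.sum_const, Finset.card_univ, Fintype.card_fin, nsmul_eq_mul]
  rw [mul_comm, ← mul_assoc, ENNReal.inv_mul_cancel hn0 (ENNReal.natCast_ne_top n), one_mul]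

end Abstract

/-! ### The growth function of caps and slices -/

/-- Among `d + 3` points of `ℝ^(d+1)` Radon's theorem finds two complementary parts with
intersecting convex hulls, and no half-space separates these. -/
theorem card_le_of_shatters_caps {d : ℕ} {ι : Type*} [Fintype ι] [DecidableEq ι] (z : ι → Sph d)
    {s : Finset ι} (hs : (patterns (fun k : Sph d × ℝ => cap k.1 k.2) z).Shatters s) :
    s.card ≤ d + 2 := by
  classical
  by_contra! hcard
  set f : s → EuclideanSpace ℝ (Fin (d + 1)) := fun i => z i with hf
  have hf' : ¬ AffineIndependent ℝ f := by
    intro h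
    have h1 := h.card_le_finrank_succ
    have h2 := Submodule.finrank_le (vectorSpan ℝ (Set.range f))
    rw [finrank_euclideanSpace, Fintype.card_fin] at h2
    rw [Fintype.card_coe] at h1
    omega
  obtain ⟨I, p, hpI, hpI'⟩ := Convex.radon_partition hf'
  obtain ⟨u, hu, hsu⟩ := hs (t := s.filter fun i => ∃ h : i ∈ s, (⟨i, h⟩ : s) ∈ I)
    (Finset.filter_subset _ _)
  obtain ⟨⟨c, τ⟩, hk⟩ := (Finset.mem_filter.1 hu).2
  have hmem : ∀ i : s, i ∈ I ↔
      τ < inner ℝ (c : EuclideanSpace ℝ (Fin (d + 1))) (f i) := by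
    intro i
    have h1 : (i : ι) ∈ s ∩ u ↔ i ∈ I := by
      rw [hsu]
      simp
    have h2 : (i : ι) ∈ u ↔ τ < inner ℝ (c : EuclideanSpace ℝ (Fin (d + 1))) (f i) := hk i
    rw [← h1, ← h2]
    simp
  have hlin : IsLinearMap ℝ fun y : EuclideanSpace ℝ (Fin (d + 1)) =>
      (inner ℝ (c : EuclideanSpace ℝ (Fin (d + 1))) y : ℝ) :=
    ⟨fun _ _ => inner_add_right _ _ _, fun _ _ => inner_smul_right _ _ _⟩
  have h1 := convexHull_min (s := f '' I) (by rintro _ ⟨i, hi, rfl⟩; exact (hmem i).1 hi)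
    (convex_halfSpace_gt hlin τ) hpI
  have h2 := convexHull_min (s := f '' Iᶜ)
    (by rintro _ ⟨i, hi, rfl⟩; exact not_lt.1 fun h => hi ((hmem i).2 h))
    (convex_halfSpace_le hlin τ) hpI'
  rw [Set.mem_ofPred_eq] at h1 h2
  exact lt_irrefl τ (h1.trans_le h2)

theorem card_patterns_caps_le {d : ℕ} {ι : Type*} [Fintype ι] (z : ι → Sph d) :
    (patterns (fun k : Sph d × ℝ => cap k.1 k.2) z).card ≤
      ∑ k ∈ Finset.Iic (d + 2), (Fintype.card ι).choose k := by
  classical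
  refine (Finset.card_le_card_shatterer _).trans
    (Finset.card_shatterer_le_sum_vcDim.trans (Finset.sum_le_sum_of_subset ?_))
  refine Finset.Iic_subset_Iic.2 (Finset.sup_le fun s hs => ?_)
  exact card_le_of_shatters_caps z (Finset.mem_shatterer.1 hs)

/-- A countable family of intersections of two caps that approximates all slices. -/
noncomputable def countableSlice (d : ℕ) (k : (ℕ × ℚ) × (ℕ × ℚ)) : Set (Sph d) :=
  haveI : Nonempty (Sph d) := (exists_unit_orthogonal ∅ (by simp)).nonempty
  cap (TopologicalSpace.denseSeq (Sph d) k.1.1) k.1.2 ∩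
    cap (TopologicalSpace.denseSeq (Sph d) k.2.1) k.2.2

theorem measurableSet_countableSlice {d : ℕ} (k : (ℕ × ℚ) × (ℕ × ℚ)) :
    MeasurableSet (countableSlice d k) :=
  (measurableSet_cap _ _).inter (measurableSet_cap _ _)

theorem card_patterns_countableSlice_le {d : ℕ} {ι : Type*} [Fintype ι] (z : ι → Sph d) :
    (patterns (countableSlice d) z).card ≤
      (∑ k ∈ Finset.Iic (d + 2), (Fintype.card ι).choose k) ^ 2 := by
  classical
  set A := patterns (fun k : Sph d × ℝ => cap k.1 k.2) z with hA
  have hsub : patterns (countableSlice d) z ⊆ Finset.image₂ (· ∩ ·) A A := by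
    intro I hI
    obtain ⟨k, hk⟩ := (Finset.mem_filter.1 hI).2
    have hcap : ∀ (x : Sph d) (t : ℝ), (Finset.univ.filter fun p => z p ∈ cap x t) ∈ A := by
      intro x t
      simp only [hA, patterns, Finset.mem_filter, Finset.mem_univ, true_and]
      exact ⟨(x, t), fun p => Iff.rfl⟩
    obtain ⟨x, t, y, s, hB⟩ : ∃ x t y s, countableSlice d k = cap x t ∩ cap y s :=
      ⟨_, _, _, _, rfl⟩
    refine Finset.mem_image₂.2 ⟨_, hcap x t, _, hcap y s, ?_⟩
    ext p
    rw [hk, hB]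
    simp
  calc _ ≤ _ := Finset.card_le_card hsub
    _ ≤ A.card * A.card := Finset.card_image₂_le _ _ _
    _ ≤ _ := by
      rw [sq]
      exact Nat.mul_le_mul (card_patterns_caps_le z) (card_patterns_caps_le z)

/-- Raise the threshold to a rational `q > t` that still keeps the finite set `F`, then move the
centre by less than `q - t`, which changes inner products with unit vectors by less than `q - t`. -/
theorem exists_countable_cap_between {d : ℕ} {D : Set (Sph d)} (hD : Dense D) (x : Sph d) (t : ℝ)
    (F : Finset (Sph d)) (hF : ∀ y ∈ F, y ∈ cap x t) :
    ∃ x' ∈ D, ∃ q : ℚ, (∀ y ∈ F, y ∈ cap x' q) ∧ cap x' q ⊆ cap x t := by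
  obtain ⟨q, htq, hq⟩ : ∃ q : ℚ, t < q ∧ ∀ y ∈ F, y ∈ cap x q := by
    induction F using Finset.cons_induction with
    | empty =>
      obtain ⟨q, hq⟩ := exists_rat_gt t
      exact ⟨q, hq, by simp⟩
    | cons y F hy ih =>
      obtain ⟨q, htq, hq⟩ := ih fun z hz => hF z (Finset.mem_cons_of_mem hz)
      obtain ⟨r, htr, hr⟩ := exists_rat_btwn
        (show t < inner ℝ (x : EuclideanSpace ℝ (Fin (d + 1))) (y : EuclideanSpace ℝ (Fin (d + 1)))
          from hF y (Finset.mem_cons_self _ _))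
      refine ⟨min q r, by rw [Rat.cast_min]; exact lt_min htq htr, fun w hw => ?_⟩
      rcases Finset.mem_cons.1 hw with rfl | hw
      · exact lt_of_le_of_lt (Rat.cast_le.2 (min_le_right _ _)) hr
      · have hqw : (q : ℝ) < inner ℝ (x : EuclideanSpace ℝ (Fin (d + 1)))
            (w : EuclideanSpace ℝ (Fin (d + 1))) := hq w hw
        exact lt_of_le_of_lt (Rat.cast_le.2 (min_le_left _ _)) hqw
  set U : Set (Sph d) := {x' | ‖(x : EuclideanSpace ℝ (Fin (d + 1))) - x'‖ < q - t} ∩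
    ⋂ y ∈ F, {x' | (q : ℝ) < inner ℝ (x' : EuclideanSpace ℝ (Fin (d + 1)))
      (y : EuclideanSpace ℝ (Fin (d + 1)))}
  have hU : IsOpen U := (isOpen_lt (by fun_prop) continuous_const).inter
    (isOpen_biInter_finset fun y _ => isOpen_lt continuous_const (by fun_prop))
  have hxU : x ∈ U := by
    refine ⟨?_, Set.mem_iInter₂.2 fun y hy => hq y hy⟩
    change ‖(x : EuclideanSpace ℝ (Fin (d + 1))) - x‖ < q - t
    rw [sub_self, norm_zero]
    exact sub_pos.2 htq
  obtain ⟨x', hx'U, hx'D⟩ := hD.inter_open_nonempty U hU ⟨x, hxU⟩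
  refine ⟨x', hx'D, q, fun y hy => Set.mem_iInter₂.1 hx'U.2 y hy, fun y hy => ?_⟩
  have h1 : (q : ℝ) < inner ℝ (x' : EuclideanSpace ℝ (Fin (d + 1)))
    (y : EuclideanSpace ℝ (Fin (d + 1))) := hy
  have h2 : ‖(x : EuclideanSpace ℝ (Fin (d + 1))) - x'‖ < q - t := hx'U.1
  have h3 := neg_le_of_abs_le (abs_real_inner_le_norm
    ((x : EuclideanSpace ℝ (Fin (d + 1))) - x') (y : EuclideanSpace ℝ (Fin (d + 1))))
  rw [norm_eq_of_mem_sphere y, mul_one, inner_sub_left] at h3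
  change t < inner ℝ (x : EuclideanSpace ℝ (Fin (d + 1))) (y : EuclideanSpace ℝ (Fin (d + 1)))
  linarith

theorem exists_countableSlice_between {d : ℕ} {B : Set (Sph d)} (hB : B ∈ slices d)
    (F : Finset (Sph d)) (hF : ∀ y ∈ F, y ∈ B) :
    ∃ k, (∀ y ∈ F, y ∈ countableSlice d k) ∧ countableSlice d k ⊆ B := by
  have : Nonempty (Sph d) := (exists_unit_orthogonal ∅ (by simp)).nonempty
  obtain ⟨x, y, t, -, s, -, rfl⟩ := hB
  have hD := TopologicalSpace.denseRange_denseSeq (Sph d)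
  obtain ⟨_, ⟨i, rfl⟩, q, hq, hq'⟩ := exists_countable_cap_between hD x t F fun z hz => (hF z hz).1
  obtain ⟨_, ⟨j, rfl⟩, r, hr, hr'⟩ := exists_countable_cap_between hD y s F fun z hz => (hF z hz).2
  exact ⟨((i, q), (j, r)), fun z hz => ⟨hq z hz, hr z hz⟩, Set.inter_subset_inter hq' hr'⟩

/-! ### An upper bound for the expected dispersion -/

theorem measurableSet_of_mem_slices {d : ℕ} {B : Set (Sph d)} (hB : B ∈ slices d) :
    MeasurableSet B := by
  obtain ⟨x, y, t, -, s, -, rfl⟩ := hB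
  exact (measurableSet_cap _ _).inter (measurableSet_cap _ _)

theorem disp_le_lintegral_emptyProportion {n d : ℕ} (hn : n ≠ 0) (X : Fin n → Sph d) :
    disp (Set.range X) ≤ ∫⁻ Y : Fin n → Sph d, emptyProportion (countableSlice d) (X, Y)
      ∂(Measure.pi fun _ => sphereMeasure d) := by
  classical
  refine iSup₂_le fun B hB => ?_
  rw [← measure_eq_lintegral_proportion (sphereMeasure d) (measurableSet_of_mem_slices hB.1) hn]
  refine lintegral_mono fun Y => ?_
  -- Approximation from inside keeps the slice free of `X`, while all points of `Y` in `B` are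
  -- retained, so a countable supremum suffices.
  obtain ⟨k, hk, hkB⟩ := exists_countableSlice_between hB.1
    ((Finset.univ.image Y).filter fun y => y ∈ B) fun y hy => (Finset.mem_filter.1 hy).2
  refine le_iSup_of_le k ?_
  rw [Set.indicator_of_mem]
  · refine ENNReal.div_le_div_right (Finset.sum_le_sum fun i _ => ?_) _
    by_cases hi : Y i ∈ B
    · have : Y i ∈ countableSlice d k := hk _ (Finset.mem_filter.2 ⟨by simp, hi⟩)
      simp [hi, this]
    · simp [hi]
  · intro i hi
    exact Set.disjoint_left.1 (Set.disjoint_iff_inter_eq_empty.2 hB.2) ⟨i, rfl⟩ (hkB hi)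

theorem expectedDisp_le {n d : ℕ} (hn : n ≠ 0) (m : ℕ) :
    expectedDisp n d ≤ (m : ℝ≥0∞) / n +
      (((∑ k ∈ Finset.Iic (d + 2), (n * 2).choose k) ^ 2 : ℕ) : ℝ≥0∞) / 2 ^ m := by
  refine (lintegral_mono fun X => disp_le_lintegral_emptyProportion hn X).trans
    (lintegral_emptyProportion_le (sphereMeasure d) measurableSet_countableSlice hn m _ fun z => ?_)
  simpa using card_patterns_countableSlice_le z

/-! ### Numerical choice of `n` and `m` -/

theorem sum_choose_mul_pow_le (N D : ℕ) {x : ℝ} (hx0 : 0 < x) (hx1 : x ≤ 1) :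
    ((∑ k ∈ Finset.Iic D, N.choose k : ℕ) : ℝ) * x ^ D ≤ (1 + x) ^ N := by
  have h1 : ((∑ k ∈ Finset.Iic D, N.choose k : ℕ) : ℝ) * x ^ D ≤
      ∑ k ∈ Finset.Iic D, x ^ k * N.choose k := by
    push_cast
    rw [Finset.sum_mul]
    refine Finset.sum_le_sum fun k hk => ?_
    rw [mul_comm]
    gcongr ?_ * _
    exact pow_le_pow_of_le_one hx0.le hx1 (Finset.mem_Iic.1 hk)
  refine h1.trans ?_
  rw [add_comm, add_pow]
  simp only [one_pow, mul_one]
  calc ∑ k ∈ Finset.Iic D, x ^ k * (N.choose k : ℝ)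
      -- The union covers `D > N`, where the additional binomial coefficients vanish.
      ≤ ∑ k ∈ Finset.Iic D ∪ Finset.range (N + 1), x ^ k * (N.choose k : ℝ) :=
        Finset.sum_le_sum_of_subset_of_nonneg Finset.subset_union_left
          fun _ _ _ => by positivity
    _ = ∑ k ∈ Finset.range (N + 1), x ^ k * (N.choose k : ℝ) := by
        refine (Finset.sum_subset Finset.subset_union_right fun k _ hk => ?_).symm
        rw [Nat.choose_eq_zero_of_lt (by simpa using hk)]
        simp

/-- Both terms `m/n` and `K²/2^m` are made at most `ε/2`; the binomial sum is bounded with `x =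
ε/96`. -/
theorem expectedDisp_le_of_exponent {n d m : ℕ} {ε : ℝ} (hn : n ≠ 0) (hε0 : 0 < ε) (hε1 : ε ≤ 1)
    (hm : m ≤ n * ε / 2)
    (hexp : n * ε / 24 + 2 * (d + 2) * Real.log (96 / ε) - m * Real.log 2 ≤ Real.log (ε / 2)) :
    expectedDisp n d ≤ ENNReal.ofReal ε := by
  set K := ∑ k ∈ Finset.Iic (d + 2), (n * 2).choose k
  set x := ε / 96 with hx
  have hx0 : 0 < x := by positivity
  have hn0 : (0 : ℝ) < n := by exact_mod_cast Nat.pos_of_ne_zero hn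
  set L := Real.log (96 / ε) with hL
  have hxL : x = Real.exp (-L) := by
    rw [hL, ← Real.log_inv, inv_div, Real.exp_log hx0]
  have hK : (K : ℝ) ≤ Real.exp (n * ε / 48 + (d + 2) * L) := by
    have h1 := sum_choose_mul_pow_le (n * 2) (d + 2) hx0 (by linarith)
    have h2 : (1 + x) ^ (n * 2) ≤ Real.exp (n * ε / 48) := by
      calc (1 + x) ^ (n * 2) ≤ (Real.exp x) ^ (n * 2) := by
            gcongr
            linarith [Real.add_one_le_exp x]
        _ = Real.exp (n * ε / 48) := by
            rw [← Real.exp_nat_mul]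
            congr 1
            push_cast
            rw [hx]
            ring
    have h3 : x ^ (d + 2) = Real.exp (-((d + 2) * L)) := by
      rw [hxL, ← Real.exp_nat_mul]
      congr 1
      push_cast
      ring
    rw [h3] at h1
    rw [Real.exp_add]
    have h4 := h1.trans h2
    rwa [Real.exp_neg, ← div_eq_mul_inv, div_le_iff₀ (Real.exp_pos _)] at h4
  have hKm : ((K ^ 2 : ℕ) : ℝ) / 2 ^ m ≤ ε / 2 := by
    have h2 : (2 : ℝ) ^ m = Real.exp (m * Real.log 2) := by
      rw [Real.exp_nat_mul, Real.exp_log two_pos]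
    calc ((K ^ 2 : ℕ) : ℝ) / 2 ^ m = (K : ℝ) ^ 2 / 2 ^ m := by push_cast; rfl
      _ ≤ (Real.exp (n * ε / 48 + (d + 2) * L)) ^ 2 / 2 ^ m := by gcongr
      _ = Real.exp (n * ε / 24 + 2 * (d + 2) * L - m * Real.log 2) := by
          rw [h2, ← Real.exp_nat_mul, ← Real.exp_sub]
          congr 1
          push_cast
          ring
      _ ≤ Real.exp (Real.log (ε / 2)) := Real.exp_le_exp.2 hexp
      _ = ε / 2 := Real.exp_log (by positivity)
  have hmn : (m : ℝ) / n ≤ ε / 2 := by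
    rw [div_le_iff₀ hn0]
    linarith
  calc expectedDisp n d ≤ (m : ℝ≥0∞) / n + ((K ^ 2 : ℕ) : ℝ≥0∞) / 2 ^ m := expectedDisp_le hn m
    _ = ENNReal.ofReal ((m : ℝ) / n + ((K ^ 2 : ℕ) : ℝ) / 2 ^ m) := by
        rw [ENNReal.ofReal_add (by positivity) (by positivity), ENNReal.ofReal_div_of_pos hn0,
          ENNReal.ofReal_div_of_pos (by positivity), ENNReal.ofReal_natCast, ENNReal.ofReal_natCast,
          ENNReal.ofReal_natCast, ENNReal.ofReal_pow two_pos.le, ENNReal.ofReal_ofNat]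
    _ ≤ ENNReal.ofReal ε := ENNReal.ofReal_le_ofReal (by linarith)

theorem one_le_log_div {ε : ℝ} (hε0 : 0 < ε) (hε1 : ε ≤ 1) : 1 ≤ Real.log (96 / ε) := by
  rw [Real.le_log_iff_exp_le (by positivity)]
  calc Real.exp 1 ≤ 96 := by linarith [Real.exp_one_lt_d9]
    _ ≤ 96 / ε := by rw [le_div_iff₀ hε0]; linarith

theorem floor_mem_admissible {d : ℕ} (hd : 1 ≤ d) {ε : ℝ} (hε0 : 0 < ε) (hε1 : ε ≤ 1) :
    ⌊96 * (d / ε) * Real.log (96 / ε)⌋₊ ∈ admissible ε d := by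
  set L := Real.log (96 / ε) with hL
  have hL1 : 1 ≤ L := one_le_log_div hε0 hε1
  have hd1 : (1 : ℝ) ≤ d := by exact_mod_cast hd
  set n := ⌊96 * (d / ε) * L⌋₊
  have hdL : 1 ≤ d * L := one_le_mul_of_one_le_of_one_le hd1 hL1
  have hT : 96 * (d / ε) * L * ε = 96 * (d * L) := by field_simp
  have hn1 : n * ε ≤ 96 * (d * L) := by
    rw [← hT]
    gcongr
    exact Nat.floor_le (by positivity)
  have hn2 : 96 * (d * L) - 1 ≤ n * ε := by
    have := Nat.lt_floor_add_one (96 * (d / ε) * L)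
    nlinarith
  have hn : n ≠ 0 := by
    intro h
    rw [h, Nat.cast_zero, zero_mul] at hn2
    linarith
  refine ⟨Nat.one_le_iff_ne_zero.2 hn,
    expectedDisp_le_of_exponent (m := ⌊n * ε / 2⌋₊) hn hε0 hε1 (Nat.floor_le (by positivity)) ?_⟩
  have hm := Nat.lt_floor_add_one (n * ε / 2)
  set m := ⌊n * ε / 2⌋₊
  have hlog : Real.log (ε / 2) ≥ -L := by
    rw [hL, ← Real.log_inv, inv_div]
    exact Real.log_le_log (by positivity) (by linarith)
  have hm2 : (48 * (d * L) - 2) * (1 / 2) ≤ m * Real.log 2 := by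
    have h2 : 1 / 2 ≤ Real.log 2 := by linarith [Real.log_two_gt_d9]
    exact mul_le_mul (by linarith) h2 (by norm_num) (by positivity)
  have hLdL : L ≤ d * L := by nlinarith
  -- The left side is at most `4dL + 6dL - (24dL - 1)`, which is below `-L` because `1 ≤ L ≤ dL`.
  nlinarith

/-! ### Bounds for the inverse of the expected dispersion -/

theorem isLeast_invExpectedDisp {d : ℕ} (hd : 1 ≤ d) {ε : ℝ} (hε0 : 0 < ε) (hε1 : ε ≤ 1) :
    IsLeast (admissible ε d) (invExpectedDisp ε d) :=
  ⟨Nat.sInf_mem ⟨_, floor_mem_admissible hd hε0 hε1⟩, fun _ hn => Nat.sInf_le hn⟩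

theorem invExpectedDisp_le {d : ℕ} (hd : 1 ≤ d) {ε : ℝ} (hε0 : 0 < ε) (hε1 : ε ≤ 1) :
    (invExpectedDisp ε d : ℝ) ≤ 96 * (d / ε) * Real.log (96 / ε) := by
  have hL := one_le_log_div hε0 hε1
  exact (Nat.cast_le.2 (Nat.sInf_le (floor_mem_admissible hd hε0 hε1))).trans
    (Nat.floor_le (by positivity))

theorem inv_le_of_mem_admissible {n d N : ℕ} {ε : ℝ} (hε0 : 0 < ε) (hn : n ∈ admissible ε d)
    (hN : 0 < N) (h : ∀ X : Fin n → Sph d, (N : ℝ≥0∞)⁻¹ ≤ disp (Set.range X)) : 1 / ε ≤ N := by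
  have hN0 : (0 : ℝ) < N := by exact_mod_cast hN
  have h1 := (le_expectedDisp h).trans hn.2
  rw [← ENNReal.ofReal_natCast, ← ENNReal.ofReal_inv_of_pos hN0,
    ENNReal.ofReal_le_ofReal_iff hε0.le] at h1
  rw [one_div]
  exact inv_le_of_inv_le₀ hN0 h1

theorem three_mul_lt_of_mem_admissible {n d : ℕ} {ε : ℝ} (hε0 : 0 < ε) (hε : ε < 1 / 4)
    (hn : n ∈ admissible ε d) : 3 * d < n + 2 := by
  by_contra! h
  have h1 := inv_le_of_mem_admissible (N := 4) hε0 hn (by norm_num)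
    fun X => by exact_mod_cast quarter_le_disp h X
  rw [div_le_iff₀ hε0] at h1
  norm_num at h1
  linarith

theorem inv_add_le_of_mem_admissible {n d : ℕ} (hd : 1 ≤ d) {ε : ℝ} (hε0 : 0 < ε)
    (hε : ε < 1 / 4) (hn : n ∈ admissible ε d) : 1 / ε + d - 2 ≤ n := by
  have h3 := three_mul_lt_of_mem_admissible hε0 hε hn
  have hdn : d ≤ n + 2 := by omega
  have h1 := inv_le_of_mem_admissible (N := n + 2 - d) hε0 hn (by omega)
    fun X => inv_le_disp hd (by omega) (by omega) X
  rw [Nat.cast_sub hdn] at h1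
  push_cast at h1
  linarith

/-- Average of `1/ε + d - 2 ≤ n` and `3d - 2 < n`. -/
theorem inv_add_two_mul_le_of_mem_admissible {n d : ℕ} (hd : 1 ≤ d) {ε : ℝ} (hε0 : 0 < ε)
    (hε : ε < 1 / 4) (hn : n ∈ admissible ε d) : 1 / (2 * ε) + 2 * d - 2 ≤ n := by
  have h3 : (3 * d : ℝ) < n + 2 := by exact_mod_cast three_mul_lt_of_mem_admissible hε0 hε hn
  have h1 := inv_add_le_of_mem_admissible hd hε0 hε hn
  have h2 : 1 / (2 * ε) = 1 / ε / 2 := by field_simp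
  rw [h2]
  linarith

theorem mul_log_le_of_mem_admissible {n d : ℕ} (hd : 1 ≤ d) {ε : ℝ} (hε0 : 0 < ε)
    (hε : ε < 1 / 18) (hn : n ∈ admissible ε d) :
    1 / (9 * ε) * Real.log (1 / (9 * ε)) ≤ n := by
  by_contra! hlt
  set M := 1 / (9 * ε) with hM
  have hM2 : 2 ≤ M := by
    rw [hM, le_div_iff₀ (by positivity)]
    linarith
  have hM0 : 0 < M := by positivity
  set k := ⌈M⌉₊
  have hk : M ≤ k := Nat.le_ceil M
  have hk' : (k : ℝ) < M + 1 := Nat.ceil_lt_add_one hM0.le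
  have hk0 : (0 : ℝ) < k := by linarith
  -- Using `k + 1` lunes turns `1 - 1/(k+1)` into `(1 + 1/k)⁻¹`, so that `1 + x ≤ exp x` applies in
  -- the right direction.
  have h1 : 1 ≤ ((k + 1 : ℕ) : ℝ) * (1 - 1 / ((k + 1 : ℕ) : ℝ)) ^ n := by
    have h2 : 1 - 1 / ((k + 1 : ℕ) : ℝ) = (1 + 1 / (k : ℝ))⁻¹ := by
      push_cast
      field_simp
      ring
    have h3 : (1 + 1 / (k : ℝ)) ^ n ≤ M := by
      calc (1 + 1 / (k : ℝ)) ^ n ≤ (Real.exp (1 / k)) ^ n := by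
            gcongr
            linarith [Real.add_one_le_exp (1 / (k : ℝ))]
        _ = Real.exp (n / k) := by
            rw [← Real.exp_nat_mul]
            congr 1
            ring
        _ ≤ Real.exp (Real.log M) := by
            refine Real.exp_le_exp.2 ?_
            rw [div_le_iff₀ hk0]
            have hlog : 0 ≤ Real.log M := Real.log_nonneg (by linarith)
            nlinarith
        _ = M := Real.exp_log hM0
    rw [h2, inv_pow, ← div_eq_mul_inv, le_div_iff₀ (by positivity)]
    push_cast
    linarith
  have h2 : 2 ≤ k + 1 := by
    have : (1 : ℝ) < k := by linarith
    have : 1 < k := by exact_mod_cast this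
    omega
  have h4 := (inv_le_expectedDisp hd h2 h1).trans hn.2
  rw [ENNReal.ofReal_le_ofReal_iff hε0.le, div_le_iff₀ (by positivity)] at h4
  have h5 : M * (9 * ε) = 1 := by rw [hM]; field_simp
  push_cast at h4
  -- Since `k + 1 < M + 2 ≤ 2M`, one gets `2(k+1)ε < 4Mε = 4/9`, contradicting `h4`.
  nlinarith

theorem lt_of_lt_one_div_nine_exp {ε : ℝ} (hε : ε < 1 / (9 * Real.exp 1)) : ε < 1 / 18 := by
  refine hε.trans_le (one_div_le_one_div_of_le (by norm_num) ?_)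
  linarith [Real.exp_one_gt_d9]

/-! ### Orders of growth in `ε` and in `d` -/

theorem isTheta_invExpectedDisp_nhdsWithin {d : ℕ} (hd : 1 ≤ d) :
    Asymptotics.IsTheta (nhdsWithin (0 : ℝ) (Set.Ioi 0))
      (fun ε : ℝ => (invExpectedDisp ε d : ℝ)) (fun ε : ℝ => 1 / ε * Real.log (1 / ε)) := by
  have hev : ∀ᶠ ε : ℝ in nhdsWithin (0 : ℝ) (Set.Ioi 0), 0 < ε ∧ ε < 1 / 96 :=
    Ioo_mem_nhdsGT (by norm_num)
  constructor
  · refine Asymptotics.IsBigO.of_bound (96 * d * 2) ?_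
    filter_upwards [hev] with ε ⟨hε0, hε⟩
    have hlog : Real.log (96 / ε) ≤ 2 * Real.log (1 / ε) := by
      rw [← Nat.cast_two, ← Real.log_pow]
      refine Real.log_le_log (by positivity) ?_
      rw [div_pow, one_pow, div_le_div_iff₀ hε0 (by positivity)]
      nlinarith
    have hlog0 : 0 ≤ Real.log (1 / ε) :=
      Real.log_nonneg (by rw [le_div_iff₀ hε0]; linarith)
    rw [Real.norm_of_nonneg (Nat.cast_nonneg _), Real.norm_of_nonneg (by positivity)]
    calc (invExpectedDisp ε d : ℝ) ≤ 96 * (d / ε) * Real.log (96 / ε) :=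
          invExpectedDisp_le hd hε0 (by linarith)
      _ ≤ 96 * (d / ε) * (2 * Real.log (1 / ε)) := by gcongr
      _ = 96 * d * 2 * (1 / ε * Real.log (1 / ε)) := by ring
  · refine Asymptotics.IsBigO.of_bound 18 ?_
    filter_upwards [hev] with ε ⟨hε0, hε⟩
    have hlog : Real.log (1 / ε) ≤ 2 * Real.log (1 / (9 * ε)) := by
      rw [← Nat.cast_two, ← Real.log_pow]
      refine Real.log_le_log (by positivity) ?_
      rw [div_pow, one_pow, div_le_div_iff₀ hε0 (by positivity)]
      nlinarith
    have hlog0 : 0 ≤ Real.log (1 / ε) :=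
      Real.log_nonneg (by rw [le_div_iff₀ hε0]; linarith)
    rw [Real.norm_of_nonneg (Nat.cast_nonneg _), Real.norm_of_nonneg (by positivity)]
    have h1 := mul_log_le_of_mem_admissible hd hε0 (by linarith)
      (isLeast_invExpectedDisp hd hε0 (by linarith)).1
    calc 1 / ε * Real.log (1 / ε) ≤ 1 / ε * (2 * Real.log (1 / (9 * ε))) := by gcongr
      _ = 18 * (1 / (9 * ε) * Real.log (1 / (9 * ε))) := by field_simp; ring
      _ ≤ _ := by gcongr

theorem isTheta_invExpectedDisp_atTop {ε : ℝ} (hε0 : 0 < ε) (hε : ε < 1 / 18) :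
    Asymptotics.IsTheta Filter.atTop (fun d : ℕ => (invExpectedDisp ε d : ℝ))
      (fun d : ℕ => (d : ℝ)) := by
  constructor
  · refine Asymptotics.IsBigO.of_bound (96 / ε * Real.log (96 / ε)) ?_
    filter_upwards [Filter.eventually_ge_atTop 1] with d hd
    rw [Real.norm_of_nonneg (Nat.cast_nonneg _), Real.norm_of_nonneg (Nat.cast_nonneg _)]
    calc (invExpectedDisp ε d : ℝ) ≤ 96 * (d / ε) * Real.log (96 / ε) :=
          invExpectedDisp_le hd hε0 (by linarith)
      _ = 96 / ε * Real.log (96 / ε) * d := by ring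
  · refine Asymptotics.IsBigO.of_bound 1 ?_
    filter_upwards [Filter.eventually_ge_atTop 1] with d hd
    rw [Real.norm_of_nonneg (Nat.cast_nonneg _), Real.norm_of_nonneg (Nat.cast_nonneg _), one_mul]
    have h1 := inv_add_le_of_mem_admissible hd hε0 (by linarith)
      (isLeast_invExpectedDisp hd hε0 (by linarith)).1
    have h2 : 2 ≤ 1 / ε := by
      rw [le_div_iff₀ hε0]
      linarith
    linarith

end SphericalDispersion

theorem mainTheorem6 :
    (∀ d : ℕ, 1 ≤ d → ∀ ε : ℝ, 0 < ε → ε < 1 / (9 * Real.exp 1) →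
      -- the minimum defining `Ñ(ε,d)` exists
      IsLeast (SphericalDispersion.admissible ε d) (SphericalDispersion.invExpectedDisp ε d) ∧
      max (max (1 / ε + d - 2) (1 / (2 * ε) + 2 * d - 2))
          (1 / (9 * ε) * Real.log (1 / (9 * ε)))
        ≤ (SphericalDispersion.invExpectedDisp ε d : ℝ) ∧
      (SphericalDispersion.invExpectedDisp ε d : ℝ) ≤ 96 * (d / ε) * Real.log (96 / ε)) ∧
    -- exact order in `ε`, for fixed `d`
    (∀ d : ℕ, 1 ≤ d →
      Asymptotics.IsTheta (nhdsWithin (0 : ℝ) (Set.Ioi 0))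
        (fun ε : ℝ => (SphericalDispersion.invExpectedDisp ε d : ℝ))
        (fun ε : ℝ => 1 / ε * Real.log (1 / ε))) ∧
    -- exact order in `d`, for fixed `ε`
    (∀ ε : ℝ, 0 < ε → ε < 1 / (9 * Real.exp 1) →
      Asymptotics.IsTheta Filter.atTop
        (fun d : ℕ => (SphericalDispersion.invExpectedDisp ε d : ℝ))
        (fun d : ℕ => (d : ℝ))) := by
  refine ⟨fun d hd ε hε0 hε => ?_,
    fun d hd => SphericalDispersion.isTheta_invExpectedDisp_nhdsWithin hd,
    fun ε hε0 hε => SphericalDispersion.isTheta_invExpectedDisp_atTop hε0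
      (SphericalDispersion.lt_of_lt_one_div_nine_exp hε)⟩
  have hε' := SphericalDispersion.lt_of_lt_one_div_nine_exp hε
  have hleast := SphericalDispersion.isLeast_invExpectedDisp hd hε0 (by linarith)
  exact ⟨hleast,
    max_le (max_le
      (SphericalDispersion.inv_add_le_of_mem_admissible hd hε0 (by linarith) hleast.1)
      (SphericalDispersion.inv_add_two_mul_le_of_mem_admissible hd hε0 (by linarith) hleast.1))
      (SphericalDispersion.mul_log_le_of_mem_admissible hd hε0 hε' hleast.1),
    SphericalDispersion.invExpectedDisp_le hd hε0 (by linarith)⟩
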